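/- Let $\Gamma$ be a simplicial graph (possibly infinite), and let $\mathcal{G}=\{G_u \mid u\in V(\Gamma)\}$ be a collection of groups indexed by its vertices. Let $\Gamma\mathcal{G}$ be the graph product, i.e. the quotient of the free product $\ast_{u\in V(\Gamma)} G_u$ by the normal closure of the commutators $[g,h]$ with $g\in G_u$, $h\in G_v$ and $\{u,v\}\in E(\Gamma)$. Let $\mathrm{QM}(\Gamma,\mathcal{G})$ be the Cayley graph of $\Gamma\mathcal{G}$ with respect to the generating set $\bigcup_{u\in V(\Gamma)} G_u\setminus\{1\}$, on which $\Gamma\mathcal{G}$ acts by left multiplication. A subgraph $Y$ of a graph $X$ is *gated* if for every vertex $x$ of $X$ there is a vertex $y$ of $Y$ (a gate of $x$) such that, for every vertex $z$ of $Y$, some geodesic of $X$ from $x$ to $z$ passes through $y$. A subgroup $H\le\Gamma\mathcal{G}$ is *gated-cocompact* if there is a gated subgraph $Y$ of $\mathrm{QM}(\Gamma,\mathcal{G})$ that is preserved by $H$ and on which $H$ acts with finitely many orbits of vertices. A subgroup $H$ of a group $A$ is a *virtual retract* of $A$ if there exist a finite-index subgroup $K\le A$ containing $H$ and a morphism $r:K\to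 H$ with $r|_H=\mathrm{Id}_H$. **Theorem.** Every gated-cocompact subgroup $H\le\Gamma\mathcal{G}$ is a virtual retract of $\Gamma\mathcal{G}$. -/

import Mathlib

namespace GraphProduct

/-- The commutators `[g, h] = g h g⁻¹ h⁻¹` in the free product of the groups `G u`, where `g ∈ G u`,
`h ∈ G v` and `u`, `v` are adjacent in `Γ`. -/
def relators {V : Type*} (Γ : SimpleGraph V) (G : V → Type*) [∀ u, Group (G u)] :
    Set (Monoid.CoprodI G) :=
  {x | ∃ u v : V, Γ.Adj u v ∧ ∃ (g : G u) (h : G v),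
    x = Monoid.CoprodI.of g * Monoid.CoprodI.of h *
      (Monoid.CoprodI.of g)⁻¹ * (Monoid.CoprodI.of h)⁻¹}

end GraphProduct

/-- The graph product of the groups `G u` over the simplicial graph `Γ`: the quotient of the free
product of the `G u` by the normal closure of the commutators `[g, h]`, where `g ∈ G u`, `h ∈ G v`
and `u`, `v` are adjacent in `Γ`. -/
def GraphProduct {V : Type*} (Γ : SimpleGraph V) (G : V → Type*) [∀ u, Group (G u)] : Type _ :=
  Monoid.CoprodI G ⧸ Subgroup.normalClosure (GraphProduct.relators Γ G)

namespace GraphProduct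

instance instGroup {V : Type*} (Γ : SimpleGraph V) (G : V → Type*) [∀ u, Group (G u)] :
    Group (GraphProduct Γ G) :=
  inferInstanceAs (Group (Monoid.CoprodI G ⧸ Subgroup.normalClosure (relators Γ G)))

/-- The canonical morphism from the vertex-group `G u` to the graph product. -/
def of {V : Type*} (Γ : SimpleGraph V) (G : V → Type*) [∀ u, Group (G u)] (u : V) :
    G u →* GraphProduct Γ G :=
  (QuotientGroup.mk' (Subgroup.normalClosure (relators Γ G))).comp
    Monoid.CoprodI.of

/-- The graph `QM(Γ, G)`: the Cayley graph of the graph product with respect to the union of the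
vertex-groups minus the identity. The graph product acts on it by left multiplication. -/
def QM {V : Type*} (Γ : SimpleGraph V) (G : V → Type*) [∀ u, Group (G u)] :
    SimpleGraph (GraphProduct Γ G) :=
  SimpleGraph.mulCayley (⋃ u : V, ((of Γ G u).range : Set (GraphProduct Γ G)) \ {1})

/-- Left multiplication is an action on `QM(Γ, G)` by graph automorphisms. -/
theorem QM_adj_smul_iff {V : Type*} (Γ : SimpleGraph V) (G : V → Type*) [∀ u, Group (G u)]
    (k x y : GraphProduct Γ G) : (QM Γ G).Adj (k • x) (k • y) ↔ (QM Γ G).Adj x y :=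
  SimpleGraph.mulCayley_adj_mul_iff_right

end GraphProduct

/-- The vertex `y` of `Y` is a gate of the vertex `x` in the subgraph `Y` of `X`: for every vertex
`z` of `Y`, some geodesic of `X` from `x` to `z` passes through `y`. -/
def SimpleGraph.Subgraph.IsGate {W : Type*} {X : SimpleGraph W} (Y : X.Subgraph) (x y : W) : Prop :=
  y ∈ Y.verts ∧ ∀ z ∈ Y.verts, ∃ p : X.Walk x z, p.length = X.dist x z ∧ y ∈ p.support

/-- A subgraph is gated if every vertex of the ambient graph admits a gate in it. -/
def SimpleGraph.Subgraph.IsGated {W : Type*} {X : SimpleGraph W} (Y : X.Subgraph) : Prop :=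
  ∀ x : W, ∃ y : W, Y.IsGate x y

/-- For a group `A` acting on (the vertices of) the graph `X`, the subgroup `H` is gated-cocompact
if `X` has a gated subgraph `Y` that is preserved by `H` and on which `H` acts with finitely many
orbits of vertices. -/
def Subgroup.IsGatedCocompact {A W : Type*} [Group A] [MulAction A W] (X : SimpleGraph W)
    (H : Subgroup A) : Prop :=
  ∃ Y : X.Subgraph, Y.IsGated ∧
    (∀ h ∈ H, ∀ x ∈ Y.verts, h • x ∈ Y.verts) ∧
    (∀ h ∈ H, ∀ x y : W, Y.Adj x y → Y.Adj (h • x) (h • y)) ∧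
    {O : Set W | ∃ y ∈ Y.verts, O = MulAction.orbit H y}.Finite

/-- The subgroup `H` of `A` is a virtual retract: some finite-index subgroup `K` of `A` contains
`H` and admits a morphism to `H` that restricts to the identity on `H`. -/
def Subgroup.IsVirtualRetract {A : Type*} [Group A] (H : Subgroup A) : Prop :=
  ∃ (K : Subgroup A) (hHK : H ≤ K) (r : K →* H),
    K.FiniteIndex ∧ ∀ h : H, r (Subgroup.inclusion hHK h) = h

/-! ### Gated subgraphs -/

namespace SimpleGraph

variable {W : Type*} {X : SimpleGraph W}

/-! Right multiplication does not preserve the vertex set of `Y`, but it can be folded: `g` in a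
vertex-group `G u` sends `y` to `y * g⁻¹` when the whole clique `y * G u` lies in `Y`, and fixes `y`
otherwise. Gatedness makes the foldings of adjacent vertex-groups commute (`foldVertex_commute`), so
`fold` is an action of the whole graph product. It commutes with left multiplication by `H`
(`coe_fold_mul_left`) and, by convexity, is right multiplication between points of `Y`
(`fold_inv_mul`). As `H` has finitely many orbits, the elements that keep a base point in its
`H`-orbit form a finite-index subgroup, which retracts onto `H` by reading off the displacement in
that orbit. -/

theorem Subgraph.IsGate.eq_or_eq_of_adj {Y : X.Subgraph} {x p y : W} (hp : Y.IsGate x p)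
    (hy : y ∈ Y.verts) (hxy : X.Adj x y) : p = x ∨ p = y := by
  obtain ⟨q, hq, hpq⟩ := hp.2 y hy
  rw [dist_eq_one_iff_adj.mpr hxy] at hq
  cases q with
  | nil => simp at hq
  | cons h r =>
    cases r with
    | nil => simpa using hpq
    | cons h' r' => simp at hq

/-- A gated subgraph contains every common neighbour of two of its vertices. -/
theorem Subgraph.IsGated.mem_of_adj_of_adj {Y : X.Subgraph} (hY : Y.IsGated) {x y z : W}
    (hy : y ∈ Y.verts) (hz : z ∈ Y.verts) (hyz : y ≠ z) (hxy : X.Adj x y) (hxz : X.Adj x z) :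
    x ∈ Y.verts := by
  obtain ⟨p, hp⟩ := hY x
  rcases hp.eq_or_eq_of_adj hy hxy with rfl | rfl
  · exact hp.1
  · rcases hp.eq_or_eq_of_adj hz hxz with rfl | h
    · exact hp.1
    · exact absurd h hyz

/-- Gated subgraphs are convex: a geodesic between two vertices stays in the subgraph. -/
theorem Subgraph.IsGated.mem_of_cons_geodesic {Y : X.Subgraph} (hY : Y.IsGated) {x w z : W}
    (hx : x ∈ Y.verts) (hz : z ∈ Y.verts) (h : X.Adj x w) (q : X.Walk w z)
    (hq : (Walk.cons h q).length = X.dist x z) : w ∈ Y.verts := by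
  classical
  obtain ⟨p, hp⟩ := hY w
  rcases hp.eq_or_eq_of_adj hx h.symm with rfl | rfl
  · exact hp.1
  · exfalso
    -- A geodesic from `w` to `z` through the earlier vertex would put that vertex no farther from
    -- `z` than `w` is.
    obtain ⟨r, hr, hpr⟩ := hp.2 z hz
    have h1 := congrArg Walk.length (r.take_spec hpr)
    rw [Walk.length_append] at h1
    have h2 := dist_le (r.dropUntil p hpr)
    have h3 := dist_le q
    rw [Walk.length_cons] at hq
    omega

end SimpleGraph

/-- A criterion for virtual retracts: `A` acts on a set `T` with a commuting action of `H` that has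
finitely many orbits, and for some base point with trivial stabiliser in `H` the elements of `H`
act in the two actions by inverse elements. -/
theorem Subgroup.isVirtualRetract_of_commuting_action {A T : Type*} [Group A] (H : Subgroup A)
    [MulAction H T] [Finite (MulAction.orbitRel.Quotient H T)] (φ : A →* Equiv.Perm T)
    (hcomm : ∀ (a : A) (h : H) (t : T), φ a (h • t) = h • φ a t) (t₀ : T)
    (hfree : ∀ h h' : H, h • t₀ = h' • t₀ → h = h')
    (hbase : ∀ h : H, φ h t₀ = h⁻¹ • t₀) : H.IsVirtualRetract := by
  -- The inverse on `k` makes `k ↦ h` a morphism rather than an anti-morphism.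
  let K : Subgroup A :=
    { carrier := {k | ∃ h : H, φ k⁻¹ t₀ = h • t₀}
      one_mem' := ⟨1, by simp⟩
      mul_mem' := by
        rintro a b ⟨h, hh⟩ ⟨h', hh'⟩
        exact ⟨h * h', by rw [mul_inv_rev, map_mul, Equiv.Perm.mul_apply, hh, hcomm, hh', smul_smul]⟩
      inv_mem' := by
        rintro a ⟨h, hh⟩
        refine ⟨h⁻¹, ?_⟩
        rw [eq_inv_smul_iff, ← hcomm, ← hh, ← Equiv.Perm.mul_apply, ← map_mul]
        simp }
  have hK : ∀ k : K, ∃ h : H, φ (k : A)⁻¹ t₀ = h • t₀ := fun k => k.2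
  choose r hr using hK
  have hHK : H ≤ K := fun h hh => ⟨⟨h, hh⟩, by simpa using hbase ⟨h, hh⟩⁻¹⟩
  refine ⟨K, hHK, MonoidHom.mk' r fun a b => hfree _ _ ?_, ?_, fun h => hfree _ _ ?_⟩
  · rw [← hr, Subgroup.coe_mul, mul_inv_rev, map_mul, Equiv.Perm.mul_apply, hr a, hcomm, hr b,
      smul_smul]
  · have : Finite (A ⧸ K) := by
      -- Cosets of `K` inject into the `H`-orbits.
      refine Finite.of_injective
        (fun c => (Quotient.mk'' (φ c.out t₀) : MulAction.orbitRel.Quotient H T)) fun c d hcd => ?_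
      obtain ⟨h, hh⟩ := MulAction.orbitRel_apply.mp (Quotient.exact hcd)
      rw [← Quotient.out_eq' c, ← Quotient.out_eq' d]
      refine (QuotientGroup.eq.mpr (K.inv_mem_iff.mp ⟨h⁻¹, ?_⟩))
      rw [inv_inv, map_mul, Equiv.Perm.mul_apply, eq_inv_smul_iff, ← hcomm, show h • φ d.out t₀ = _ from hh,
        ← Equiv.Perm.mul_apply, ← map_mul]
      simp
    exact Subgroup.finiteIndex_of_finite_quotient
  · change r _ • t₀ = _
    rw [← hr]
    simpa using hbase h⁻¹

/-! ### Graph products and the folded action -/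

namespace GraphProduct

variable {V : Type*} {Γ : SimpleGraph V} {G : V → Type*} [∀ u, Group (G u)]

theorem QM_adj_iff {x y : GraphProduct Γ G} :
    (QM Γ G).Adj x y ↔ x ≠ y ∧ ∃ (u : V) (g : G u), y = x * of Γ G u g := by
  rw [QM, SimpleGraph.mulCayley_adj']
  refine and_congr_right fun hxy => ⟨?_, ?_⟩
  · rintro ⟨s, hs, h⟩
    obtain ⟨u, ⟨g, rfl⟩, -⟩ := Set.mem_iUnion.mp hs
    rcases h with h | h
    · exact ⟨u, g, h.symm⟩
    · exact ⟨u, g⁻¹, by rw [h, map_inv, mul_inv_cancel_right]⟩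
  · rintro ⟨u, g, rfl⟩
    exact ⟨of Γ G u g, Set.mem_iUnion.mpr ⟨u, ⟨g, rfl⟩, by simpa using hxy⟩, Or.inl rfl⟩

theorem commute_of_of_adj {u v : V} (huv : Γ.Adj u v) (g : G u) (h : G v) :
    Commute (of Γ G u g) (of Γ G v h) := by
  have key : of Γ G u g * of Γ G v h * (of Γ G u g)⁻¹ * (of Γ G v h)⁻¹ = 1 :=
    (QuotientGroup.eq_one_iff (N := Subgroup.normalClosure (relators Γ G)) _).mpr
      (Subgroup.subset_normalClosure ⟨u, v, huv, g, h, rfl⟩)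
  rw [mul_inv_eq_one, mul_inv_eq_iff_eq_mul] at key
  exact key

/-- The universal property of the graph product. -/
def lift {N : Type*} [Group N] (f : ∀ u, G u →* N)
    (hf : ∀ u v, Γ.Adj u v → ∀ (g : G u) (h : G v), Commute (f u g) (f v h)) :
    GraphProduct Γ G →* N :=
  QuotientGroup.lift (Subgroup.normalClosure (relators Γ G)) (Monoid.CoprodI.lift f) <| by
    refine Subgroup.normalClosure_le_normal ?_
    rintro _ ⟨u, v, huv, g, h, rfl⟩
    simp only [SetLike.mem_coe, MonoidHom.mem_ker, map_mul, map_inv, Monoid.CoprodI.lift_of]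
    rw [(hf u v huv g h).eq]
    group

theorem lift_of {N : Type*} [Group N] (f : ∀ u, G u →* N)
    (hf : ∀ u v, Γ.Adj u v → ∀ (g : G u) (h : G v), Commute (f u g) (f v h)) (u : V) (g : G u) :
    lift f hf (of Γ G u g) = f u g :=
  Monoid.CoprodI.lift_of f g

theorem hom_induction {motive : GraphProduct Γ G → Prop} (x : GraphProduct Γ G) (one : motive 1)
    (of : ∀ u (g : G u), motive (of Γ G u g))
    (mul : ∀ x y, motive x → motive y → motive (x * y)) : motive x := by
  obtain ⟨m, rfl⟩ := QuotientGroup.mk_surjective x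
  induction m using Monoid.CoprodI.induction_on with
  | one => exact one
  | of u g => exact of u g
  | mul x y hx hy => exact mul _ _ hx hy

section Gated

/-- The clique `y * G u` is contained in `S`. -/
def CliqueSubset (Γ : SimpleGraph V) (S : Set (GraphProduct Γ G)) (u : V)
    (y : GraphProduct Γ G) : Prop :=
  ∀ g : G u, y * of Γ G u g ∈ S

variable {Y : (QM Γ G).Subgraph}

theorem cliqueSubset_mul_of {S : Set (GraphProduct Γ G)} {u : V} {y : GraphProduct Γ G} (g : G u) :
    CliqueSubset Γ S u (y * of Γ G u g) ↔ CliqueSubset Γ S u y := by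
  refine ⟨fun h k => ?_, fun h k => ?_⟩
  · simpa [mul_assoc] using h (g⁻¹ * k)
  · simpa [mul_assoc] using h (g * k)

/-- If a gated subgraph contains two vertices of a clique, then it contains the clique. -/
theorem cliqueSubset_of_isGated (hY : Y.IsGated) {u : V} {y : GraphProduct Γ G} {g : G u}
    (hy : y ∈ Y.verts) (hg : y * of Γ G u g ∈ Y.verts) (hne : y ≠ y * of Γ G u g) :
    CliqueSubset Γ Y.verts u y := by
  intro k
  by_cases h1 : y * of Γ G u k = y
  · rwa [h1]
  by_cases h2 : y * of Γ G u k = y * of Γ G u g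
  · rwa [h2]
  refine hY.mem_of_adj_of_adj hy hg hne (QM_adj_iff.mpr ⟨h1, u, k⁻¹, ?_⟩)
    (QM_adj_iff.mpr ⟨h2, u, k⁻¹ * g, ?_⟩)
  · simp
  · simp [mul_assoc]

/-- A gated subgraph that contains three corners of a square contains the fourth one. -/
theorem mul_of_mul_of_mem (hY : Y.IsGated) {u v : V} (huv : Γ.Adj u v) {y : GraphProduct Γ G}
    {g : G u} {h : G v} (hy : y ∈ Y.verts) (hg : y * of Γ G u g ∈ Y.verts)
    (hh : y * of Γ G v h ∈ Y.verts) : y * of Γ G u g * of Γ G v h ∈ Y.verts := by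
  have hc : y * of Γ G u g * of Γ G v h = y * of Γ G v h * of Γ G u g := by
    rw [mul_assoc, (commute_of_of_adj huv g h).eq, mul_assoc]
  by_cases h1 : y * of Γ G u g * of Γ G v h = y * of Γ G u g
  · rwa [h1]
  by_cases h2 : y * of Γ G u g * of Γ G v h = y * of Γ G v h
  · rwa [h2]
  -- Injectivity of `of` is not used, so the square may degenerate; its corners then all lie in one
  -- clique.
  by_cases h3 : y * of Γ G u g = y * of Γ G v h
  · have hne : y ≠ y * of Γ G u g := by
      intro h
      rw [h3] at h
      exact h1 (by rw [mul_eq_left]; exact mul_eq_left.mp h.symm)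
    rw [hc, ← h3]
    exact (cliqueSubset_mul_of g).mpr (cliqueSubset_of_isGated hY hy hg hne) g
  refine hY.mem_of_adj_of_adj hg hh h3 (QM_adj_iff.mpr ⟨h1, v, h⁻¹, ?_⟩)
    (QM_adj_iff.mpr ⟨h2, u, g⁻¹, ?_⟩)
  · simp
  · simp [hc]

/-- Completing squares in `Y` carries one clique to the other. Hence moving along `v` does not
affect whether `u` moves or fixes a vertex. -/
theorem cliqueSubset_mul_of_iff (hY : Y.IsGated) {u v : V} (huv : Γ.Adj u v)
    {y : GraphProduct Γ G} {h : G v} (hy : y ∈ Y.verts) (hh : y * of Γ G v h ∈ Y.verts) :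
    CliqueSubset Γ Y.verts u (y * of Γ G v h) ↔ CliqueSubset Γ Y.verts u y := by
  refine ⟨fun H g => ?_, fun H g => ?_⟩
  · have := mul_of_mul_of_mem hY huv (g := g) (h := h⁻¹) hh (H g) (by simpa using hy)
    rwa [mul_assoc, (commute_of_of_adj huv g h⁻¹).eq, mul_assoc, ← mul_assoc (of Γ G v h), map_inv,
      mul_inv_cancel, one_mul] at this
  · have := mul_of_mul_of_mem hY huv (g := g) (h := h) hy (H g) hh
    rwa [mul_assoc, (commute_of_of_adj huv g h).eq, ← mul_assoc] at this

open Classical in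
/-- The element `g` of the vertex-group `G u` moves a vertex `y` of `S` to `y * g⁻¹` if `S` contains
the clique `y * G u`, and fixes `y` otherwise. -/
noncomputable def foldFun (S : Set (GraphProduct Γ G)) (u : V) (g : G u) (y : S) : S :=
  if h : CliqueSubset Γ S u y then ⟨y * of Γ G u g⁻¹, h g⁻¹⟩ else y

theorem coe_foldFun_of_clique {S : Set (GraphProduct Γ G)} {u : V} (g : G u) {y : S}
    (h : CliqueSubset Γ S u y) : (foldFun S u g y : GraphProduct Γ G) = y * of Γ G u g⁻¹ := by
  rw [foldFun, dif_pos h]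

theorem foldFun_of_not_clique {S : Set (GraphProduct Γ G)} {u : V} (g : G u) {y : S}
    (h : ¬ CliqueSubset Γ S u y) : foldFun S u g y = y := by
  rw [foldFun, dif_neg h]

/-- The action of a vertex-group on a set of vertices that is given by `foldFun`. -/
noncomputable def foldVertex (S : Set (GraphProduct Γ G)) (u : V) : G u →* Equiv.Perm S :=
  @MulAction.toPermHom (G u) S _
    { smul := foldFun S u
      one_smul := fun y => by
        change foldFun S u 1 y = y
        by_cases h : CliqueSubset Γ S u y
        · ext
          simp [coe_foldFun_of_clique _ h]
        · exact foldFun_of_not_clique _ h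
      mul_smul := fun a b y => by
        change foldFun S u (a * b) y = foldFun S u a (foldFun S u b y)
        by_cases h : CliqueSubset Γ S u y
        · have h' : CliqueSubset Γ S u (foldFun S u b y) := by
            rw [coe_foldFun_of_clique b h, cliqueSubset_mul_of]
            exact h
          ext
          simp [coe_foldFun_of_clique _ h, coe_foldFun_of_clique _ h', mul_assoc]
        · simp [foldFun_of_not_clique _ h] }

theorem foldVertex_apply (S : Set (GraphProduct Γ G)) (u : V) (g : G u) (y : S) :
    foldVertex S u g y = foldFun S u g y := rfl

theorem foldVertex_commute (hY : Y.IsGated) {u v : V} (huv : Γ.Adj u v) (g : G u) (h : G v) :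
    Commute (foldVertex Y.verts u g) (foldVertex Y.verts v h) := by
  ext y
  simp only [Equiv.Perm.mul_apply, foldVertex_apply]
  by_cases hu : CliqueSubset Γ Y.verts u y
  · have hu' : CliqueSubset Γ Y.verts v (foldFun Y.verts u g y) ↔ CliqueSubset Γ Y.verts v y := by
      rw [coe_foldFun_of_clique g hu]
      exact cliqueSubset_mul_of_iff hY huv.symm y.2 (hu _)
    by_cases hv : CliqueSubset Γ Y.verts v y
    · have hv' : CliqueSubset Γ Y.verts u (foldFun Y.verts v h y) := by
        rw [coe_foldFun_of_clique h hv]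
        exact (cliqueSubset_mul_of_iff hY huv y.2 (hv _)).mpr hu
      rw [coe_foldFun_of_clique g hv', coe_foldFun_of_clique h (hu'.mpr hv),
        coe_foldFun_of_clique g hu, coe_foldFun_of_clique h hv, mul_assoc, mul_assoc,
        (commute_of_of_adj huv g⁻¹ h⁻¹).eq]
    · rw [foldFun_of_not_clique h hv, foldFun_of_not_clique h (hu'.not.mpr hv)]
  · by_cases hv : CliqueSubset Γ Y.verts v y
    · have hv' : ¬ CliqueSubset Γ Y.verts u (foldFun Y.verts v h y) := by
        rw [coe_foldFun_of_clique h hv, cliqueSubset_mul_of_iff hY huv y.2 (hv _)]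
        exact hu
      rw [foldFun_of_not_clique g hv', foldFun_of_not_clique g hu]
    · rw [foldFun_of_not_clique h hv, foldFun_of_not_clique g hu, foldFun_of_not_clique h hv]

/-- The action of the graph product on the vertices of a gated subgraph that is obtained from right
multiplication by folding along the boundary of the subgraph. -/
noncomputable def fold (hY : Y.IsGated) : GraphProduct Γ G →* Equiv.Perm Y.verts :=
  lift (foldVertex Y.verts) fun _ _ huv g h => foldVertex_commute hY huv g h

theorem fold_of (hY : Y.IsGated) (u : V) (g : G u) (y : Y.verts) :
    fold hY (of Γ G u g) y = foldFun Y.verts u g y := by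
  rw [fold, lift_of, foldVertex_apply]

/-- Inside the gated subgraph, the folded action is right multiplication. -/
theorem fold_of_walk (hY : Y.IsGated) {x z : GraphProduct Γ G} (p : (QM Γ G).Walk x z) :
    p.length = (QM Γ G).dist x z → ∀ (hx : x ∈ Y.verts) (hz : z ∈ Y.verts),
      fold hY (z⁻¹ * x) ⟨x, hx⟩ = ⟨z, hz⟩ := by
  induction p with
  | nil => simp
  | @cons x w z h q ih =>
    intro hp hx hz
    have hw := hY.mem_of_cons_geodesic hx hz h q hp
    have hq : q.length = (QM Γ G).dist w z := by
      obtain ⟨r, hr⟩ := q.reachable.exists_walk_length_eq_dist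
      have h1 := SimpleGraph.dist_le (SimpleGraph.Walk.cons h r)
      have h2 := SimpleGraph.dist_le q
      rw [SimpleGraph.Walk.length_cons] at h1 hp
      omega
    have hstep : fold hY (w⁻¹ * x) ⟨x, hx⟩ = ⟨w, hw⟩ := by
      obtain ⟨hne, u, g, rfl⟩ := QM_adj_iff.mp h
      have hc := cliqueSubset_of_isGated hY hx hw hne
      have : (x * of Γ G u g)⁻¹ * x = of Γ G u g⁻¹ := by simp
      rw [this, fold_of]
      ext
      rw [coe_foldFun_of_clique _ hc, inv_inv]
    rw [show z⁻¹ * x = z⁻¹ * w * (w⁻¹ * x) by group, map_mul, Equiv.Perm.mul_apply, hstep,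
      ih hq hw hz]

/-- The walks supplied by a gate give the connectedness needed to choose a geodesic. -/
theorem fold_inv_mul (hY : Y.IsGated) (x z : Y.verts) :
    fold hY ((z : GraphProduct Γ G)⁻¹ * x) x = z := by
  obtain ⟨p, hp⟩ := hY x
  obtain ⟨r, -⟩ := hp.2 z z.2
  obtain ⟨s, hs⟩ := r.reachable.exists_walk_length_eq_dist
  exact fold_of_walk hY s hs x.2 z.2

/-- The folded action commutes with the elements that preserve the subgraph. -/
theorem coe_fold_mul_left (hY : Y.IsGated) {k : GraphProduct Γ G}
    (hk : ∀ x, k * x ∈ Y.verts ↔ x ∈ Y.verts) (a : GraphProduct Γ G) :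
    ∀ y : Y.verts, (fold hY a ⟨k * y, (hk _).mpr y.2⟩ : GraphProduct Γ G) = k * fold hY a y := by
  induction a using hom_induction with
  | one => simp
  | of u g =>
    intro y
    have hc : CliqueSubset Γ Y.verts u (k * y) ↔ CliqueSubset Γ Y.verts u y := by
      simp only [CliqueSubset, mul_assoc, hk]
    rw [fold_of, fold_of]
    by_cases h : CliqueSubset Γ Y.verts u y
    · rw [coe_foldFun_of_clique g h, coe_foldFun_of_clique g (hc.mpr h), mul_assoc]
    · rw [foldFun_of_not_clique g h, foldFun_of_not_clique g (hc.not.mpr h)]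
  | mul a b ha hb =>
    intro y
    rw [map_mul, Equiv.Perm.mul_apply, Equiv.Perm.mul_apply, ← ha]
    congr 2
    exact Subtype.ext (hb y)

end Gated

end GraphProduct

open GraphProduct in
theorem mainTheorem3 {V : Type*} (Γ : SimpleGraph V) (G : V → Type*) [∀ u, Group (G u)]
    (H : Subgroup (GraphProduct Γ G)) (hH : H.IsGatedCocompact (GraphProduct.QM Γ G)) :
    H.IsVirtualRetract := by
  obtain ⟨Y, hY, hHY, -, hfin⟩ := hH
  obtain ⟨y₀, hy₀, -⟩ := hY 1
  let T : SubMulAction H (GraphProduct Γ G) := ⟨Y.verts, fun h {x} hx => hHY h h.2 x hx⟩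
  have hmem : ∀ k ∈ H, ∀ x, k * x ∈ Y.verts ↔ x ∈ Y.verts := fun k hk x =>
    ⟨fun h => by simpa using hHY k⁻¹ (H.inv_mem hk) _ h, hHY k hk x⟩
  have : Finite (MulAction.orbitRel.Quotient H T) := by
    have := hfin.to_subtype
    refine Finite.of_injective (β := {O : Set (GraphProduct Γ G) |
      ∃ y ∈ Y.verts, O = MulAction.orbit H y})
      (fun c => ⟨MulAction.orbit H (c.out : GraphProduct Γ G), c.out, c.out.2, rfl⟩) fun c d hcd => ?_
    rw [← Quotient.out_eq' c, ← Quotient.out_eq' d]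
    have h1 : (c.out : GraphProduct Γ G) ∈ MulAction.orbit H (d.out : GraphProduct Γ G) := by
      rw [← MulAction.orbit_eq_iff]
      exact congrArg Subtype.val hcd
    obtain ⟨h, hh⟩ := h1
    exact Quotient.sound ⟨h, Subtype.ext hh⟩
  -- `Y` need not contain `1`. Conjugating moves the base point to `y₀`: with `z = h⁻¹ * y₀`, the
  -- element `y₀⁻¹ * h * y₀` equals `z⁻¹ * y₀`, which folds `y₀` to `z`.
  let φ : GraphProduct Γ G →* Equiv.Perm T := (fold hY).comp (MulAut.conj y₀⁻¹).toMonoidHom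
  refine H.isVirtualRetract_of_commuting_action φ (fun a h t => ?_) ⟨y₀, hy₀⟩ (fun h h' e => ?_)
    fun h => ?_
  · exact Subtype.ext (coe_fold_mul_left hY (hmem h h.2) _ t)
  · exact Subtype.ext (mul_right_cancel (congrArg Subtype.val e))
  · have hy : (h : GraphProduct Γ G)⁻¹ * y₀ ∈ Y.verts := hHY _ (H.inv_mem h.2) _ hy₀
    have key := fold_inv_mul hY ⟨y₀, hy₀⟩ ⟨_, hy⟩
    change fold hY (y₀⁻¹ * h * y₀⁻¹⁻¹) _ = _
    refine Eq.trans ?_ key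
    simp [mul_assoc]
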